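/- **Notation.** Let $U$ be a finite set. A statistical query is a function $q:U\to\mathbb R$; on a dataset $x=(x_1,\dots,x_n)\in U^n$ its value is $q(x)=\frac1n\sum_{i=1}^n q(x_i)$. The query matrix $Q$ of a sequence $\mathcal Q=(q_1,\dots,q_m)$ has the table of values of $q_t$ as its $t$-th row, and $Q_t$ consists of the first $t$ rows of $Q$. For a real matrix $A$, $\gamma_2(A)=\min\{\|L\|_{2\to\infty}\|R\|_{1\to2}: LR=A\}$, where $\|L\|_{2\to\infty}$ is the maximum Euclidean norm of a row of $L$ and $\|R\|_{1\to 2}$ the maximum Euclidean norm of a column of $R$. An interactive algorithm holds a dataset $x\in U^n$, receives queries one at a time, and answers each query by a real number that may depend on $x$, on the queries received so far and on its random coins, but not on later queries. It is $(\varepsilon,\delta)$-differentially private if, for every sequence of queries $q_1,\dots,q_m$ fixed in advance, all $x,x'\in U^n$ that differ in exactly one data point and every measurable $S\subseteq\mathbb R^m$, its answers satisfy $\Pr[a(x)\in S]\le e^{\varepsilon}\Pr[a(x')\in S]+\delta$. **Theorem.** For every positive integer $N$ there is a sequence $\mathcal Q=\mathcal Q^{(N)}=(q_1,\dots,q_N)$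 of statistical queries on the universe $U=\{1,\dots,N\}$, with $N\times N$ query matrix $Q$, such that $\|q_1\|_\infty=1$; there are absolute constants $a,b>0$ with $aN\le\log_2\gamma_2(Q)\le bN$ for all $N\ge2$; for $N$ a power of two, $q_t=2^{(t-1)/2}h_t$ where $h_1,\dots,h_N$ are the rows of a Hadamard matrix; and the following lower bounds hold. For $\varepsilon>0$ and $c>0$, consider the statement $(\ast)$ there is $n_0$ such that for every $n\ge n_0$, every $(\varepsilon,\delta)$-differentially private interactive algorithm $M$ on datasets of size $n$ over $U$, and every real $C$: if for every $x\in U^n$ the answers $a_1,\dots,a_N$ of $M$ to the queries $q_1,\dots,q_N$, given online, satisfy with probability at least $\frac23$ $$|q_t(x)-a_t|\le\frac{C\,\gamma_2(Q_t)}{\varepsilon n}\qquad\text{for all }t\in\{1,\dots,N\},$$ then $C\ge c\sqrt{\log_2\gamma_2(Q)}$. 1. There are absolute constants $c,\eta>0$ such that $(\ast)$ holds for all $N\ge1$, all $\varepsilon\in(0,1]$ and all $\delta\in[0,\eta\varepsilon]$. 2. For all $\varepsilon>0$ and $\delta\in[0,\frac23)$ there are $c>0$ and $N_0$, depending only on $\varepsilon$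 and $\delta$, such that $(\ast)$ holds for all $N\ge N_0$. -/

import Mathlib

open MeasureTheory

universe u v

noncomputable section

/-- `‖L‖_{2→∞}`: the largest Euclidean norm of a row of `L`. -/
def maxRowNorm {m k : Type*} [Fintype k] (L : Matrix m k ℝ) : ℝ :=
  ⨆ i, Real.sqrt (∑ j, L i j ^ 2)

/-- `‖R‖_{1→2}`: the largest Euclidean norm of a column of `R`. -/
def maxColNorm {k n : Type*} [Fintype k] (R : Matrix k n ℝ) : ℝ :=
  ⨆ j, Real.sqrt (∑ i, R i j ^ 2)

/-- The factorization norm `γ₂(A)`: the least value of `‖L‖_{2→∞} ‖R‖_{1→2}` over all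
factorizations `A = L R` through some `ℝ^k`. -/
def gammaTwo {m n : Type*} (A : Matrix m n ℝ) : ℝ :=
  sInf {r : ℝ | ∃ (k : ℕ) (L : Matrix m (Fin k) ℝ) (R : Matrix (Fin k) n ℝ),
    L * R = A ∧ r = maxRowNorm L * maxColNorm R}

/-- The answer `q(x) = (1/n) ∑ᵢ q(xᵢ)` of the statistical query `q : U → ℝ` on a dataset `x`. -/
def queryAnswer {U : Type*} {n : ℕ} (q : U → ℝ) (x : Fin n → U) : ℝ :=
  (∑ i, q (x i)) / n

/-- The query matrix of a sequence of queries: the `t`-th row is the table of values of `q_t`. -/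
def queryMatrix {U : Type*} {m : ℕ} (q : Fin m → U → ℝ) : Matrix (Fin m) U ℝ :=
  Matrix.of q

/-- `Q_t`: the rows of the query matrix up to and including row `t`. -/
def queryPrefix {U : Type*} {m : ℕ} (q : Fin m → U → ℝ) (t : Fin m) :
    Matrix {i : Fin m // i ≤ t} U ℝ :=
  (queryMatrix q).submatrix Subtype.val id

/-- Two datasets of size `n` are neighboring if they differ in exactly one data point. -/
def Neighboring {U : Type*} {n : ℕ} (x x' : Fin n → U) : Prop :=
  ∃! i, x i ≠ x' i

/-- `(ε, δ)`-differential privacy of a randomized algorithm, given by its output law on each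
dataset of size `n`. -/
def IsDifferentiallyPrivate {U R : Type*} [MeasurableSpace R] {n : ℕ}
    (law : (Fin n → U) → Measure R) (ε δ : ℝ) : Prop :=
  ∀ x x' : Fin n → U, Neighboring x x' → ∀ S : Set R, MeasurableSet S →
    (law x).real S ≤ Real.exp ε * (law x').real S + δ

/-- A randomized interactive algorithm on datasets of size `n` over the universe `U`, answering
statistical queries that arrive one at a time. Its coins are a point `ω` of a probability space,
drawn once; the answer to the most recent query is a function of the dataset, of the queries
received so far (in order of arrival, the most recent one last), and of the coins. It depends
neither on later queries nor on their number. -/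
structure InteractiveAlgorithm (U : Type v) (n : ℕ) where
  Ω : Type u
  [measurableSpace : MeasurableSpace Ω]
  coins : Measure Ω
  [isProbabilityMeasure : IsProbabilityMeasure coins]
  answer : (Fin n → U) → List (U → ℝ) → Ω → ℝ
  measurable_answer : ∀ x l, Measurable (answer x l)

attribute [instance] InteractiveAlgorithm.measurableSpace
attribute [instance] InteractiveAlgorithm.isProbabilityMeasure

namespace InteractiveAlgorithm

variable {U : Type v} {n : ℕ}

/-- The answers `(a_1, …, a_m)` when the queries `q_1, …, q_m` are given one after the other. -/
def answers (M : InteractiveAlgorithm.{u, v} U n) (x : Fin n → U) {m : ℕ}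
    (q : Fin m → U → ℝ) (ω : M.Ω) : Fin m → ℝ :=
  fun t => M.answer x ((List.ofFn q).take (t + 1)) ω

/-- The law of the answers given to the queries `q_1, …, q_m` on the dataset `x`. -/
def transcriptLaw (M : InteractiveAlgorithm.{u, v} U n) {m : ℕ} (q : Fin m → U → ℝ)
    (x : Fin n → U) : Measure (Fin m → ℝ) :=
  M.coins.map (M.answers x q)

/-- `(ε, δ)`-differential privacy for non-adaptive analysts: for every sequence of queries fixed in
advance, the transcript is `(ε, δ)`-differentially private as a function of the dataset. -/
def IsPrivate (M : InteractiveAlgorithm.{u, v} U n) (ε δ : ℝ) : Prop :=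
  ∀ (m : ℕ) (q : Fin m → U → ℝ), IsDifferentiallyPrivate (M.transcriptLaw q) ε δ

/-- On every dataset `x`, with probability at least `2/3`, the answers to the queries `q` satisfy
`|q_t(x) - a_t| ≤ C γ₂(Q_t) / (ε n)` for all `t`. -/
def IsAccurate (M : InteractiveAlgorithm.{u, v} U n) {m : ℕ} (q : Fin m → U → ℝ)
    (ε C : ℝ) : Prop :=
  ∀ x : Fin n → U,
    2 / 3 ≤ M.coins.real {ω | ∀ t : Fin m,
      |queryAnswer (q t) x - M.answers x q ω t| ≤ C * gammaTwo (queryPrefix q t) / (ε * n)}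

end InteractiveAlgorithm

/-- For all large enough `n`, every `(ε, δ)`-differentially private interactive algorithm on
datasets of size `n` which answers `q` online with error `C γ₂(Q_t) / (ε n)` has
`C ≥ c √(log₂ γ₂(Q))`. -/
def ErrorFactorAtLeast {U : Type v} {m : ℕ} (q : Fin m → U → ℝ) (ε δ c : ℝ) : Prop :=
  ∃ n₀ : ℕ, ∀ n ≥ n₀, ∀ M : InteractiveAlgorithm.{u, v} U n, M.IsPrivate ε δ →
    ∀ C : ℝ, M.IsAccurate q ε C →
      c * Real.sqrt (Real.logb 2 (gammaTwo (queryMatrix q))) ≤ C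

end

/-! The norm `γ₂(Q_t)` grows no faster than the scale `√2 ^ t` of the `t`-th query. Undoing the
scaling and inverting the Hadamard matrix therefore turns accurate online answers into a private
estimate of the whole histogram, with squared Euclidean error at most `2 C² / ε²`.

No private estimate has squared error `o(m / ε²)`, where `m` is the order of the Hadamard matrix.
Plant an arbitrary word in the dataset, its letters being blocks of data points with well separated
histograms, placed in disjoint parts of the universe. A small total error makes most letters
decodable. Averaging over all words with the product weights `∏ i, w (b i)`, where
`w a = exp (-ε d a)` and `d a` bounds the Hamming distance of the letter `a` from a reference
letter, gives one position such that the probabilities `P a` of decoding a letter `a` correctly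
there have a large sum `∑ a, w a * P a`. By group privacy `w a * P a` is, up to a multiple of `δ`,
at most the probability of decoding `a` when the letter there is the reference letter, and these
probabilities add up to at most `1` because the decoding regions are disjoint. -/

theorem sqrt_sum_sq_row_le_maxRowNorm {m k : Type*} [Finite m] [Fintype k] (L : Matrix m k ℝ)
    (i : m) : √(∑ j, L i j ^ 2) ≤ maxRowNorm L :=
  le_ciSup (f := fun i => √(∑ j, L i j ^ 2)) (Set.finite_range _).bddAbove i

theorem sqrt_sum_sq_col_le_maxColNorm {k n : Type*} [Fintype k] [Finite n] (R : Matrix k n ℝ)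
    (j : n) : √(∑ i, R i j ^ 2) ≤ maxColNorm R :=
  le_ciSup (f := fun j => √(∑ i, R i j ^ 2)) (Set.finite_range _).bddAbove j

theorem maxRowNorm_nonneg {m k : Type*} [Fintype k] (L : Matrix m k ℝ) : 0 ≤ maxRowNorm L :=
  Real.iSup_nonneg fun _ => Real.sqrt_nonneg _

theorem maxColNorm_nonneg {k n : Type*} [Fintype k] (R : Matrix k n ℝ) : 0 ≤ maxColNorm R :=
  Real.iSup_nonneg fun _ => Real.sqrt_nonneg _

theorem gammaTwo_mul_le {m n : Type*} {k : ℕ} (L : Matrix m (Fin k) ℝ) (R : Matrix (Fin k) n ℝ) :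
    gammaTwo (L * R) ≤ maxRowNorm L * maxColNorm R := by
  refine csInf_le ⟨0, ?_⟩ ⟨k, L, R, rfl, rfl⟩
  rintro _ ⟨k, L, R, -, rfl⟩
  exact mul_nonneg (maxRowNorm_nonneg L) (maxColNorm_nonneg R)

theorem one_submatrix_mul_submatrix_equivFin {m n : Type*} [Fintype m] [DecidableEq m]
    (A : Matrix m n ℝ) :
    (1 : Matrix m m ℝ).submatrix id (Fintype.equivFin m).symm *
      A.submatrix (Fintype.equivFin m).symm id = A := by
  rw [Matrix.submatrix_mul_equiv, Matrix.one_mul, Matrix.submatrix_id_id]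

theorem gammaTwo_le_of_sum_sq_col_le {m n : Type*} [Fintype m] (A : Matrix m n ℝ) {s : ℝ}
    (hs : 0 ≤ s) (h : ∀ j, ∑ i, A i j ^ 2 ≤ s ^ 2) : gammaTwo A ≤ s := by
  classical
  set e := (Fintype.equivFin m).symm
  have hL : maxRowNorm ((1 : Matrix m m ℝ).submatrix id e) ≤ 1 := by
    refine Real.iSup_le (fun i => Real.sqrt_le_one.2 ?_) zero_le_one
    calc ∑ j, (1 : Matrix m m ℝ).submatrix id e i j ^ 2
        = ∑ j, (1 : Matrix m m ℝ) i j ^ 2 := Equiv.sum_comp e fun j => (1 : Matrix m m ℝ) i j ^ 2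
      _ ≤ 1 := by simp [Matrix.one_apply]
  have hR : maxColNorm (A.submatrix e id) ≤ s := by
    refine Real.iSup_le (fun j => Real.sqrt_le_iff.2 ⟨hs, ?_⟩) hs
    exact (Equiv.sum_comp e fun i => A i j ^ 2).trans_le (h j)
  calc gammaTwo A
      = gammaTwo ((1 : Matrix m m ℝ).submatrix id e * A.submatrix e id) := by
        rw [one_submatrix_mul_submatrix_equivFin]
    _ ≤ maxRowNorm ((1 : Matrix m m ℝ).submatrix id e) * maxColNorm (A.submatrix e id) :=
        gammaTwo_mul_le _ _
    _ ≤ 1 * s := mul_le_mul hL hR (maxColNorm_nonneg _) zero_le_one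
    _ = s := one_mul s

theorem abs_apply_le_gammaTwo {m n : Type*} [Finite m] [Finite n] (A : Matrix m n ℝ)
    (i : m) (j : n) : |A i j| ≤ gammaTwo A := by
  classical
  have := Fintype.ofFinite m
  refine le_csInf ⟨_, _, _, _, one_submatrix_mul_submatrix_equivFin A, rfl⟩ ?_
  rintro _ ⟨k, L, R, rfl, rfl⟩
  calc |(L * R) i j| = √((∑ l, L i l * R l j) ^ 2) := by
        rw [Matrix.mul_apply, Real.sqrt_sq_eq_abs]
    _ ≤ √((∑ l, L i l ^ 2) * ∑ l, R l j ^ 2) :=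
        Real.sqrt_le_sqrt (Finset.sum_mul_sq_le_sq_mul_sq _ _ _)
    _ = √(∑ l, L i l ^ 2) * √(∑ l, R l j ^ 2) := Real.sqrt_mul (by positivity) _
    _ ≤ maxRowNorm L * maxColNorm R :=
        mul_le_mul (sqrt_sum_sq_row_le_maxRowNorm L i) (sqrt_sum_sq_col_le_maxColNorm R j)
          (Real.sqrt_nonneg _) (maxRowNorm_nonneg L)

section Hadamard

open Matrix

/-- Sylvester's Hadamard matrices: the Kronecker powers of `!![1, 1; 1, -1]`. -/
noncomputable def sylvesterMatrix : (k : ℕ) → Matrix (Fin (2 ^ k)) (Fin (2 ^ k)) ℝ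
  | 0 => 1
  | k + 1 =>
    let e : Fin (2 ^ k) × Fin 2 ≃ Fin (2 ^ (k + 1)) :=
      finProdFinEquiv.trans (finCongr (pow_succ 2 k).symm)
    reindex e e (kronecker (sylvesterMatrix k) !![1, 1; 1, -1])

theorem isHadamard_one_of_unique {m : Type*} [Fintype m] [DecidableEq m] [Unique m] :
    (1 : Matrix m m ℝ).IsHadamard :=
  ⟨fun i j => by rw [Subsingleton.elim i j, one_apply_eq]; exact one_mem _, by simp, by simp⟩

theorem isHadamard_two : (!![1, 1; 1, -1] : Matrix (Fin 2) (Fin 2) ℝ).IsHadamard := by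
  refine ⟨fun i j => ?_, ?_, ?_⟩
  · fin_cases i <;> fin_cases j <;> simp [Unitary.mem_iff]
  all_goals ext i j; fin_cases i <;> fin_cases j <;> norm_num [Matrix.mul_apply]

theorem isHadamard_sylvesterMatrix (k : ℕ) : (sylvesterMatrix k).IsHadamard := by
  induction k with
  | zero =>
    have : Unique (Fin (2 ^ 0)) := inferInstanceAs (Unique (Fin 1))
    exact isHadamard_one_of_unique
  | succ k ih => exact (ih.kronecker isHadamard_two).reindex _ _

variable {m : Type*} [Fintype m] [DecidableEq m] {H : Matrix m m ℝ}

theorem abs_apply_of_isHadamard (hH : H.IsHadamard) (i j : m) : |H i j| = 1 :=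
  CStarRing.norm_of_mem_unitary (hH.apply_mem i j)

theorem sum_sq_transpose_mulVec_of_isHadamard (hH : H.IsHadamard) (v : m → ℝ) :
    ∑ u, (Hᵀ *ᵥ v) u ^ 2 = Fintype.card m * ∑ t, v t ^ 2 := by
  have hHH : H * Hᵀ = (Fintype.card m : ℝ) • 1 := hH.mul_conjTranspose
  calc ∑ u, (Hᵀ *ᵥ v) u ^ 2 = (v ᵥ* H) ⬝ᵥ (Hᵀ *ᵥ v) := by
        simp only [mulVec_transpose, dotProduct, sq]
    _ = v ⬝ᵥ ((H * Hᵀ) *ᵥ v) := by rw [← dotProduct_mulVec, mulVec_mulVec]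
    _ = Fintype.card m * ∑ t, v t ^ 2 := by
        rw [hHH, smul_mulVec, one_mulVec, dotProduct_smul, smul_eq_mul]
        simp only [dotProduct, sq]

theorem sum_sq_transpose_mulVec_div_card_sub_of_isHadamard [Nonempty m] (hH : H.IsHadamard)
    (y z : m → ℝ) :
    ∑ u, ((Hᵀ *ᵥ y) u / Fintype.card m - z u) ^ 2 =
      (∑ t, (y t - (H *ᵥ z) t) ^ 2) / Fintype.card m := by
  have hm : (Fintype.card m : ℝ) ≠ 0 := Nat.cast_ne_zero.2 Fintype.card_ne_zero
  have hHH : Hᵀ * H = (Fintype.card m : ℝ) • 1 := hH.conjTranspose_mul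
  have herror : ∀ u, (Hᵀ *ᵥ y) u / Fintype.card m - z u =
      (Hᵀ *ᵥ (y - H *ᵥ z)) u / Fintype.card m := fun u => by
    rw [mulVec_sub, mulVec_mulVec, hHH, smul_mulVec, one_mulVec, Pi.sub_apply, Pi.smul_apply,
      smul_eq_mul]
    field_simp
  simp only [herror, div_pow, ← Finset.sum_div]
  rw [sum_sq_transpose_mulVec_of_isHadamard hH]
  simp only [Pi.sub_apply]
  field_simp

end Hadamard

/-- The rows of `H`, scaled geometrically by powers of `√2`, as queries on `Fin N`: they vanish on
points beyond the columns of `H`, and there are null queries beyond the rows of `H`. -/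
noncomputable def scaledRowQueries (N : ℕ) {m : ℕ} (H : Matrix (Fin m) (Fin m) ℝ)
    (t u : Fin N) : ℝ :=
  if h : t.1 < m ∧ u.1 < m then √2 ^ (t : ℕ) * H ⟨t, h.1⟩ ⟨u, h.2⟩ else 0

section ScaledRowQueries

variable {N m : ℕ} {H : Matrix (Fin m) (Fin m) ℝ}

theorem scaledRowQueries_castLE (hm : m ≤ N) (t u : Fin m) :
    scaledRowQueries N H (Fin.castLE hm t) (Fin.castLE hm u) = √2 ^ (t : ℕ) * H t u := by
  simp [scaledRowQueries]

theorem sq_sqrt_two_pow (t : ℕ) : (√2 ^ t) ^ 2 = 2 ^ t := by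
  rw [pow_right_comm, Real.sq_sqrt zero_le_two]

theorem sq_scaledRowQueries_le (hH : H.IsHadamard) (t u : Fin N) :
    scaledRowQueries N H t u ^ 2 ≤ if t.1 < m then 2 ^ (t : ℕ) else 0 := by
  by_cases ht : t.1 < m
  · by_cases hu : u.1 < m
    · simp [scaledRowQueries, ht, hu, mul_pow, ← sq_abs (H _ _), abs_apply_of_isHadamard hH,
        sq_sqrt_two_pow]
    · simp [scaledRowQueries, ht, hu]
  · simp [scaledRowQueries, ht]

theorem sum_sq_scaledRowQueries_le (hH : H.IsHadamard) {s : Finset (Fin N)} {k : ℕ}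
    (hs : ∀ t ∈ s, t.1 < m → t.1 < k) (u : Fin N) :
    ∑ t ∈ s, scaledRowQueries N H t u ^ 2 ≤ 2 ^ k - 1 := by
  calc ∑ t ∈ s, scaledRowQueries N H t u ^ 2
      ≤ ∑ t ∈ s, if t.1 < m then (2 : ℝ) ^ (t : ℕ) else 0 :=
        Finset.sum_le_sum fun t _ => sq_scaledRowQueries_le hH t u
    _ = ∑ t ∈ ({t ∈ s | t.1 < m} : Finset _).map Fin.valEmbedding, (2 : ℝ) ^ t := by
        rw [← Finset.sum_filter, Finset.sum_map]
        rfl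
    _ ≤ ∑ t ∈ Finset.range k, (2 : ℝ) ^ t := by
        refine Finset.sum_le_sum_of_subset_of_nonneg (fun i hi => ?_) fun _ _ _ => by positivity
        obtain ⟨t, ht, rfl⟩ := Finset.mem_map.1 hi
        exact Finset.mem_range.2 (hs t (Finset.mem_filter.1 ht).1 (Finset.mem_filter.1 ht).2)
    _ = 2 ^ k - 1 := by
        rw [geom_sum_eq (by norm_num)]
        norm_num

theorem gammaTwo_queryPrefix_scaledRowQueries_le (hH : H.IsHadamard) (t : Fin N) :
    gammaTwo (queryPrefix (scaledRowQueries N H) t) ≤ √2 ^ ((t : ℕ) + 1) := by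
  refine gammaTwo_le_of_sum_sq_col_le _ (by positivity) fun u => ?_
  calc ∑ i : {i : Fin N // i ≤ t}, scaledRowQueries N H i u ^ 2
      = ∑ i ∈ Finset.Iic t, scaledRowQueries N H i u ^ 2 :=
        (Finset.sum_subtype _ (fun _ => Finset.mem_Iic) fun i => scaledRowQueries N H i u ^ 2).symm
    _ ≤ 2 ^ ((t : ℕ) + 1) - 1 :=
        sum_sq_scaledRowQueries_le hH (s := Finset.Iic t)
          (fun _ hi _ => Nat.lt_succ_of_le (Fin.le_def.1 (Finset.mem_Iic.1 hi))) u
    _ ≤ (√2 ^ ((t : ℕ) + 1)) ^ 2 := by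
        rw [sq_sqrt_two_pow]
        exact sub_le_self _ zero_le_one

theorem gammaTwo_scaledRowQueries_le (hH : H.IsHadamard) (hm0 : 0 < m) :
    gammaTwo (queryMatrix (scaledRowQueries N H)) ≤ 2 ^ (m - 1) := by
  refine gammaTwo_le_of_sum_sq_col_le _ (by positivity) fun u => ?_
  refine (sum_sq_scaledRowQueries_le hH (fun _ _ => id) u).trans ?_
  obtain ⟨k, rfl⟩ := Nat.exists_eq_add_one_of_ne_zero hm0.ne'
  rw [Nat.add_sub_cancel, pow_succ]
  linarith [sq_nonneg ((2 : ℝ) ^ k - 1)]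

theorem sqrt_two_pow_le_gammaTwo_scaledRowQueries (hH : H.IsHadamard) (hm : m ≤ N) (hm0 : 0 < m) :
    √2 ^ (m - 1) ≤ gammaTwo (queryMatrix (scaledRowQueries N H)) := by
  let t : Fin m := ⟨m - 1, by omega⟩
  calc √2 ^ (m - 1) = |scaledRowQueries N H (Fin.castLE hm t) (Fin.castLE hm t)| := by
        rw [scaledRowQueries_castLE, abs_mul, abs_apply_of_isHadamard hH, mul_one,
          abs_of_nonneg (by positivity)]
    _ ≤ gammaTwo (queryMatrix (scaledRowQueries N H)) :=
        abs_apply_le_gammaTwo (queryMatrix (scaledRowQueries N H)) _ _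

theorem logb_gammaTwo_scaledRowQueries_le (hH : H.IsHadamard) (hm : m ≤ N) (hm0 : 0 < m) :
    Real.logb 2 (gammaTwo (queryMatrix (scaledRowQueries N H))) ≤ (m - 1 : ℕ) := by
  have hpos : 0 < gammaTwo (queryMatrix (scaledRowQueries N H)) :=
    lt_of_lt_of_le (by positivity) (sqrt_two_pow_le_gammaTwo_scaledRowQueries hH hm hm0)
  rw [Real.logb_le_iff_le_rpow one_lt_two hpos, Real.rpow_natCast]
  exact gammaTwo_scaledRowQueries_le hH hm0

theorem half_le_logb_gammaTwo_scaledRowQueries (hH : H.IsHadamard) (hm : m ≤ N) (hm0 : 0 < m) :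
    ((m - 1 : ℕ) : ℝ) / 2 ≤ Real.logb 2 (gammaTwo (queryMatrix (scaledRowQueries N H))) := by
  calc ((m - 1 : ℕ) : ℝ) / 2 = Real.logb 2 (√2 ^ (m - 1)) := by
        rw [Real.logb_pow, Real.sqrt_eq_rpow, Real.logb_rpow two_pos (by norm_num)]
        ring
    _ ≤ _ := Real.logb_le_logb_of_le one_lt_two (by positivity)
        (sqrt_two_pow_le_gammaTwo_scaledRowQueries hH hm hm0)

theorem gammaTwo_queryPrefix_scaledRowQueries_pos (hH : H.IsHadamard) (hm : m ≤ N) (t : Fin m) :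
    0 < gammaTwo (queryPrefix (scaledRowQueries N H) (Fin.castLE hm t)) := by
  have hentry : 0 < |scaledRowQueries N H (Fin.castLE hm t) (Fin.castLE hm t)| := by
    rw [scaledRowQueries_castLE, abs_mul, abs_apply_of_isHadamard hH]
    positivity
  exact hentry.trans_le
    (abs_apply_le_gammaTwo (queryPrefix (scaledRowQueries N H) (Fin.castLE hm t)) ⟨_, le_rfl⟩ _)

theorem norm_scaledRowQueries_zero (hH : H.IsHadamard) (hm : m ≤ N) (hm0 : 0 < m) :
    ‖scaledRowQueries N H ⟨0, hm0.trans_le hm⟩‖ = 1 := by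
  refine le_antisymm ((pi_norm_le_iff_of_nonneg zero_le_one).2 fun u => ?_) ?_
  · have hsq := sq_scaledRowQueries_le hH ⟨0, hm0.trans_le hm⟩ u
    rw [if_pos hm0, pow_zero] at hsq
    exact (sq_le_one_iff_abs_le_one _).1 hsq
  · calc (1 : ℝ) = ‖scaledRowQueries N H (Fin.castLE hm ⟨0, hm0⟩) (Fin.castLE hm ⟨0, hm0⟩)‖ := by
          rw [scaledRowQueries_castLE, pow_zero, one_mul, Real.norm_eq_abs,
            abs_apply_of_isHadamard hH]
      _ ≤ _ := norm_le_pi_norm _ _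

end ScaledRowQueries

section Privacy

variable {U R : Type*} {n : ℕ}

theorem exists_neighboring_hammingDist_lt [DecidableEq U] {x x' : Fin n → U} (h : x ≠ x') :
    ∃ y, Neighboring x y ∧ hammingDist y x' < hammingDist x x' := by
  obtain ⟨i, hi⟩ := Function.ne_iff.1 h
  refine ⟨Function.update x i (x' i), ⟨i, by simpa using hi, fun j hj => ?_⟩, ?_⟩
  · contrapose! hj
    rw [Function.update_of_ne hj]
  · refine Finset.card_lt_card ((Finset.ssubset_iff_of_subset fun j hj => ?_).2
      ⟨i, by simpa using hi, by simp⟩)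
    obtain rfl | hji := eq_or_ne j i
    · simp at hj
    · simpa [Function.update_of_ne hji] using hj

variable [MeasurableSpace R] {law : (Fin n → U) → Measure R} {ε δ : ℝ}

theorem IsDifferentiallyPrivate.measureReal_le_of_hammingDist_le [DecidableEq U]
    (h : IsDifferentiallyPrivate law ε δ) (hε : 0 ≤ ε) (hδ : 0 ≤ δ) {S : Set R}
    (hS : MeasurableSet S) {k : ℕ} {x x' : Fin n → U} (hk : hammingDist x x' ≤ k) :
    (law x).real S ≤
      Real.exp ε ^ k * (law x').real S + δ * ∑ i ∈ Finset.range k, Real.exp ε ^ i := by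
  induction k generalizing x with
  | zero => simp [hammingDist_eq_zero.1 (Nat.le_zero.1 hk)]
  | succ k ih =>
    obtain rfl | hne := eq_or_ne x x'
    · exact (le_mul_of_one_le_left measureReal_nonneg
        (one_le_pow₀ (Real.one_le_exp hε))).trans (le_add_of_nonneg_right (by positivity))
    · obtain ⟨y, hxy, hlt⟩ := exists_neighboring_hammingDist_lt hne
      calc (law x).real S ≤ Real.exp ε * (law y).real S + δ := h x y hxy S hS
        _ ≤ Real.exp ε * (Real.exp ε ^ k * (law x').real S +
              δ * ∑ i ∈ Finset.range k, Real.exp ε ^ i) + δ := by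
            gcongr
            exact ih (by omega)
        _ = _ := by
            rw [geom_sum_succ, pow_succ']
            ring

theorem IsDifferentiallyPrivate.comp_injective {U' : Type*} {f : U' → U}
    (h : IsDifferentiallyPrivate law ε δ) (hf : Function.Injective f) :
    IsDifferentiallyPrivate (fun x => law (f ∘ x)) ε δ := fun x x' hx =>
  h _ _ (by simpa only [Neighboring, Function.comp_apply, hf.ne_iff] using hx)

theorem IsDifferentiallyPrivate.map {R' : Type*} [MeasurableSpace R'] {f : R → R'}
    (h : IsDifferentiallyPrivate law ε δ) (hf : Measurable f) :
    IsDifferentiallyPrivate (fun x => (law x).map f) ε δ := fun x x' hx S hS => by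
  rw [map_measureReal_apply hf hS, map_measureReal_apply hf hS]
  exact h x x' hx _ (hf hS)

end Privacy

section Averaging

theorem mul_measureReal_le_sum_measureReal {R I : Type*} [MeasurableSpace R] [Fintype I]
    (μ : Measure R) [IsFiniteMeasure μ] {G : Set R} {E : I → Set R}
    (hE : ∀ i, MeasurableSet (E i)) {r : ℝ} (hr : 0 ≤ r)
    (h : ∀ y ∈ G, r ≤ ∑ i, (E i).indicator 1 y) :
    r * μ.real G ≤ ∑ i, μ.real (E i) := by
  have hint : ∀ i, Integrable ((E i).indicator (1 : R → ℝ)) μ :=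
    fun i => (integrable_const 1).indicator (hE i)
  have hnonneg : 0 ≤ fun y => ∑ i, (E i).indicator (1 : R → ℝ) y := fun y =>
    Finset.sum_nonneg fun i _ => Set.indicator_nonneg (fun _ _ => zero_le_one) y
  calc r * μ.real G ≤ r * μ.real {y | r ≤ ∑ i, (E i).indicator (1 : R → ℝ) y} := by
        gcongr
        · exact measure_ne_top _ _
        · exact h
    _ ≤ ∫ y, ∑ i, (E i).indicator (1 : R → ℝ) y ∂μ :=
        mul_meas_ge_le_integral_of_nonneg (Filter.Eventually.of_forall hnonneg)
          (integrable_finsetSum _ fun i _ => hint i) r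
    _ = ∑ i, μ.real (E i) := by
        rw [integral_finsetSum _ fun i _ => hint i]
        exact Finset.sum_congr rfl fun i _ => integral_indicator_one (hE i)

theorem card_sub_div_sq_le_sum_indicator_ball {I V : Type*} [Fintype I] [PseudoMetricSpace V]
    {ρ B : ℝ} (hρ : 0 < ρ) {z v : I → V} (h : ∑ i, dist (z i) (v i) ^ 2 ≤ B) :
    Fintype.card I - B / ρ ^ 2 ≤
      ∑ i, (Metric.ball (v i) ρ).indicator (1 : V → ℝ) (z i) := by
  have hterm : ∀ i, 1 - dist (z i) (v i) ^ 2 / ρ ^ 2 ≤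
      (Metric.ball (v i) ρ).indicator (1 : V → ℝ) (z i) := fun i => by
    by_cases hi : z i ∈ Metric.ball (v i) ρ
    · rw [Set.indicator_of_mem hi]
      exact sub_le_self _ (by positivity)
    · rw [Set.indicator_of_notMem hi, sub_nonpos, one_le_div (by positivity)]
      exact pow_le_pow_left₀ hρ.le (not_lt.1 (mt Metric.mem_ball.2 hi)) 2
  calc Fintype.card I - B / ρ ^ 2
      ≤ Fintype.card I - (∑ i, dist (z i) (v i) ^ 2) / ρ ^ 2 := by gcongr
    _ = ∑ i, (1 - dist (z i) (v i) ^ 2 / ρ ^ 2) := by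
        simp [Finset.sum_sub_distrib, Finset.sum_div]
    _ ≤ _ := Finset.sum_le_sum fun i _ => hterm i

theorem mul_card_sub_le_sum_measureReal_ball {R I V : Type*} [MeasurableSpace R] [Fintype I]
    [PseudoMetricSpace V] [MeasurableSpace V] [OpensMeasurableSpace V] (μ : Measure R)
    [IsFiniteMeasure μ] {est : I → R → V} (hest : ∀ i, Measurable (est i)) (v : I → V)
    {p ρ B : ℝ} (hp : 0 ≤ p) (hρ : 0 < ρ)
    (h : p ≤ μ.real {y | ∑ i, dist (est i y) (v i) ^ 2 ≤ B}) :
    p * (Fintype.card I - B / ρ ^ 2) ≤ ∑ i, μ.real (est i ⁻¹' Metric.ball (v i) ρ) := by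
  obtain hr | hr := le_total (Fintype.card I - B / ρ ^ 2) 0
  · exact (mul_nonpos_of_nonneg_of_nonpos hp hr).trans
      (Finset.sum_nonneg fun i _ => measureReal_nonneg)
  calc p * (Fintype.card I - B / ρ ^ 2)
      ≤ (Fintype.card I - B / ρ ^ 2) * μ.real {y | ∑ i, dist (est i y) (v i) ^ 2 ≤ B} := by
        rw [mul_comm]
        gcongr
    _ ≤ ∑ i, μ.real (est i ⁻¹' Metric.ball (v i) ρ) :=
        mul_measureReal_le_sum_measureReal μ (fun i => hest i Metric.isOpen_ball.measurableSet) hr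
          fun y hy => card_sub_div_sq_le_sum_indicator_ball hρ hy

theorem sum_prod_mul_sum_update {I A : Type*} [Fintype I] [DecidableEq I] [Fintype A]
    (wt : A → ℝ) (f : (I → A) → ℝ) (i : I) :
    ∑ b : I → A, (∏ j, wt (b j)) * ∑ a, wt a * f (Function.update b i a) =
      (∑ a, wt a) * ∑ b : I → A, (∏ j, wt (b j)) * f b := by
  have hswap : ∀ (b : I → A) a,
      (∏ j, wt (b j)) * wt a = (∏ j, wt (Function.update b i a j)) * wt (b i) := fun b a => by
    have hupdate : (fun j => wt (Function.update b i a j)) = Function.update (wt ∘ b) i (wt a) :=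
      Function.comp_update wt b i a
    rw [hupdate, Finset.prod_update_of_mem (Finset.mem_univ i),
      Finset.prod_eq_mul_prod_sdiff_singleton_of_mem (Finset.mem_univ i)]
    simp only [Function.comp_apply]
    ring
  have hinv : Function.Involutive fun p : (I → A) × A => (Function.update p.1 i p.2, p.1 i) :=
    fun p => by simp
  calc ∑ b : I → A, (∏ j, wt (b j)) * ∑ a, wt a * f (Function.update b i a)
      = ∑ p : (I → A) × A, (∏ j, wt (p.1 j)) * wt p.2 * f (Function.update p.1 i p.2) := by
        simp only [Fintype.sum_prod_type, Finset.mul_sum, mul_assoc]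
    _ = ∑ p : (I → A) × A, (∏ j, wt (p.1 j)) * wt p.2 * f p.1 :=
        Fintype.sum_bijective _ hinv.bijective _ _ fun p => by rw [hswap]
    _ = (∑ a, wt a) * ∑ b : I → A, (∏ j, wt (b j)) * f b := by
        rw [Fintype.sum_prod_type_right, Finset.sum_mul]
        refine Finset.sum_congr rfl fun a _ => ?_
        rw [Finset.mul_sum]
        exact Finset.sum_congr rfl fun b _ => by ring

theorem exists_mul_sum_le_card_mul_sum_update {I A : Type*} [Fintype I] [DecidableEq I]
    [Nonempty I] [Fintype A] [Nonempty A] {wt : A → ℝ} (hwt : ∀ a, 0 < wt a)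
    (f : I → (I → A) → ℝ) {r : ℝ} (h : ∀ b, r ≤ ∑ i, f i b) :
    ∃ i b, r * ∑ a, wt a ≤ Fintype.card I * ∑ a, wt a * f i (Function.update b i a) := by
  set W : (I → A) → ℝ := fun b => ∏ j, wt (b j)
  have hW : ∀ b, 0 < W b := fun b => Finset.prod_pos fun j _ => hwt _
  have hwt0 : 0 ≤ ∑ a, wt a := Finset.sum_nonneg fun a _ => (hwt a).le
  have hsum : ∑ p : I × (I → A), W p.2 * (r * ∑ a, wt a) ≤ ∑ p : I × (I → A),
      W p.2 * (Fintype.card I * ∑ a, wt a * f p.1 (Function.update p.2 p.1 a)) := by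
    calc ∑ p : I × (I → A), W p.2 * (r * ∑ a, wt a)
        = Fintype.card I * ((∑ a, wt a) * ∑ b, W b * r) := by
          simp only [Fintype.sum_prod_type, ← Finset.sum_mul, Finset.sum_const, Finset.card_univ,
            nsmul_eq_mul]
          ring
      _ ≤ Fintype.card I * ((∑ a, wt a) * ∑ b, W b * ∑ i, f i b) := by
          gcongr with b
          · exact (hW b).le
          · exact h b
      _ = ∑ i, Fintype.card I * ((∑ a, wt a) * ∑ b, W b * f i b) := by
          simp only [← Finset.mul_sum]
          rw [Finset.sum_comm]
          simp only [← Finset.mul_sum]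
      _ = _ := by
          rw [Fintype.sum_prod_type]
          refine Finset.sum_congr rfl fun i _ => ?_
          rw [← sum_prod_mul_sum_update, Finset.mul_sum]
          exact Finset.sum_congr rfl fun b _ => mul_left_comm _ _ _
  obtain ⟨⟨i, b⟩, -, hib⟩ := Finset.exists_le_of_sum_le Finset.univ_nonempty hsum
  exact ⟨i, b, le_of_mul_le_mul_left hib (hW b)⟩

theorem sum_inv_mul_sub_le_one_of_disjoint {R A : Type*} [MeasurableSpace R] [Fintype A]
    {μ : A → Measure R} {ν : Measure R} [IsProbabilityMeasure ν] {E : A → Set R}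
    (hE : ∀ a, MeasurableSet (E a)) (hdisj : Pairwise (Function.onFun Disjoint E)) {M η : A → ℝ}
    (hM : ∀ a, 0 < M a) (h : ∀ a, (μ a).real (E a) ≤ M a * ν.real (E a) + η a) :
    ∑ a, (M a)⁻¹ * ((μ a).real (E a) - η a) ≤ 1 := by
  calc ∑ a, (M a)⁻¹ * ((μ a).real (E a) - η a) ≤ ∑ a, ν.real (E a) := by
        gcongr with a
        rw [inv_mul_le_iff₀ (hM a), sub_le_iff_le_add]
        exact h a
    _ = ν.real (⋃ a, E a) := (measureReal_iUnion_fintype hdisj hE).symm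
    _ ≤ 1 := measureReal_le_one

theorem mul_card_sub_mul_sum_le_of_decoding {R I A V : Type*} [MeasurableSpace R] [Fintype I]
    [DecidableEq I] [Nonempty I] [Fintype A] [PseudoMetricSpace V] [MeasurableSpace V]
    [OpensMeasurableSpace V] {law : (I → A) → Measure R} [∀ b, IsProbabilityMeasure (law b)]
    {est : I → R → V} (hest : ∀ i, Measurable (est i)) {w : A → V} {p ρ B : ℝ} (hp : 0 ≤ p)
    (hρ : 0 < ρ) (hw : Pairwise fun a a' => 2 * ρ ≤ dist (w a) (w a'))
    (hacc : ∀ b, p ≤ (law b).real {y | ∑ i, dist (est i y) (w (b i)) ^ 2 ≤ B}) (c : A)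
    {M η : A → ℝ} (hM : ∀ a, 0 < M a)
    (hclose : ∀ b i a S, MeasurableSet S → (law (Function.update b i a)).real S ≤
      M a * (law (Function.update b i c)).real S + η a) :
    p * (Fintype.card I - B / ρ ^ 2) * ∑ a, (M a)⁻¹ ≤
      Fintype.card I * (1 + ∑ a, (M a)⁻¹ * η a) := by
  have : Nonempty A := ⟨c⟩
  obtain ⟨i, b, hib⟩ := exists_mul_sum_le_card_mul_sum_update (fun a => inv_pos.2 (hM a))
    (fun i b => (law b).real (est i ⁻¹' Metric.ball (w (b i)) ρ)) fun b =>
      mul_card_sub_le_sum_measureReal_ball (law b) hest (fun i => w (b i)) hp hρ (hacc b)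
  have hball : ∀ a, MeasurableSet (est i ⁻¹' Metric.ball (w a) ρ) := fun a =>
    hest i Metric.isOpen_ball.measurableSet
  have hdisj : Pairwise (Function.onFun Disjoint fun a => est i ⁻¹' Metric.ball (w a) ρ) :=
    fun a a' haa => (Metric.ball_disjoint_ball (by linarith [hw haa])).preimage _
  have hpack := sum_inv_mul_sub_le_one_of_disjoint hball hdisj hM fun a => hclose b i a _ (hball a)
  simp only [Function.update_self] at hib
  simp only [mul_sub, Finset.sum_sub_distrib, sub_le_iff_le_add] at hpack
  exact hib.trans (mul_le_mul_of_nonneg_left hpack (Nat.cast_nonneg _))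

end Averaging

section Histogram

/-- The histogram of a dataset `x`: the number of data points equal to `u`, for each `u`. -/
def histogram {ι U : Type*} [Fintype ι] [DecidableEq U] (x : ι → U) (u : U) : ℝ :=
  Finset.card {i | x i = u}

theorem sum_comp_eq_sum_mul_histogram {ι U : Type*} [Fintype ι] [Fintype U] [DecidableEq U]
    (q : U → ℝ) (x : ι → U) : ∑ i, q (x i) = ∑ u, q u * histogram x u := by
  rw [← Finset.sum_fiberwise Finset.univ x]
  refine Finset.sum_congr rfl fun u _ => ?_
  rw [Finset.sum_congr rfl fun i hi => congrArg q (Finset.mem_filter.1 hi).2, Finset.sum_const,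
    nsmul_eq_mul, mul_comm, histogram]

theorem histogram_comp_apply {ι U U' : Type*} [Fintype ι] [DecidableEq U] [DecidableEq U']
    {f : U' → U} (hf : Function.Injective f) (x : ι → U') (u : U') :
    histogram (f ∘ x) (f u) = histogram x u := by
  simp only [histogram, Function.comp_apply, hf.eq_iff]

/-- The law of a randomized histogram estimator for datasets of size `n`: on every dataset, its
squared Euclidean error is at most `B` with probability at least `p`. -/
def EstimatesHistogram {U : Type*} [Fintype U] [DecidableEq U] {n : ℕ}
    (law : (Fin n → U) → Measure (U → ℝ)) (p B : ℝ) : Prop :=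
  ∀ x, p ≤ (law x).real {z | ∑ u, (z u - histogram x u) ^ 2 ≤ B}

variable {U : Type*} [Fintype U] [DecidableEq U] {n : ℕ} {law : (Fin n → U) → Measure (U → ℝ)}
  {p B : ℝ}

theorem EstimatesHistogram.nonneg [Nonempty U] (h : EstimatesHistogram law p B) (hp : 0 < p) :
    0 ≤ B := by
  have hpos := hp.trans_le (h fun _ => Classical.arbitrary U)
  obtain ⟨z, hz⟩ := nonempty_of_measureReal_ne_zero hpos.ne'
  exact (Finset.sum_nonneg fun u _ => sq_nonneg _).trans hz

theorem EstimatesHistogram.comp_injective {U' : Type*} [Fintype U'] [DecidableEq U'] {f : U' → U}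
    (h : EstimatesHistogram law p B) [∀ x, IsFiniteMeasure (law x)] (hf : Function.Injective f) :
    EstimatesHistogram (fun x => (law (f ∘ x)).map (· ∘ f)) p B := fun x => by
  have hcomp : Measurable fun z : U → ℝ => z ∘ f := by fun_prop
  rw [map_measureReal_apply hcomp (measurableSet_le (by fun_prop) measurable_const)]
  refine (h (f ∘ x)).trans (measureReal_mono fun z hz => ?_)
  calc ∑ u, ((z ∘ f) u - histogram x u) ^ 2
      = ∑ u ∈ Finset.univ.map ⟨f, hf⟩, (z u - histogram (f ∘ x) u) ^ 2 := by
        simp [histogram_comp_apply hf]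
    _ ≤ ∑ u, (z u - histogram (f ∘ x) u) ^ 2 :=
        Finset.sum_le_univ_sum_of_nonneg fun _ => sq_nonneg _
    _ ≤ B := hz

end Histogram

section PlantedDataset

variable {I J S : Type*} {n : ℕ}

/-- The dataset with the block `b i` planted at the positions `pos (i, s)`, for every `i`: its
points `some j` become `some (i, j)`, and all the other data points are the dummy point `none`. -/
noncomputable def plantedDataset (pos : I × S ↪ Fin n) (b : I → S → Option J) :
    Fin n → Option (I × J) :=
  Function.extend pos (fun l => (b l.1 l.2).map (l.1, ·)) fun _ => none

variable (pos : I × S ↪ Fin n)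

theorem plantedDataset_eq_some_iff (b : I → S → Option J) (l : Fin n) (i : I) (j : J) :
    plantedDataset pos b l = some (i, j) ↔ ∃ s, pos (i, s) = l ∧ b i s = some j := by
  by_cases hl : ∃ q, pos q = l
  · obtain ⟨⟨i', s⟩, rfl⟩ := hl
    rw [plantedDataset, pos.injective.extend_apply]
    obtain rfl | hi := eq_or_ne i' i
    · simp
    · simp [hi, hi.symm]
  · rw [plantedDataset, Function.extend_apply' _ _ _ hl]
    simpa using fun s hs => (hl ⟨(i, s), hs⟩).elim

theorem histogram_plantedDataset [DecidableEq I] [DecidableEq J] [Fintype S]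
    (b : I → S → Option J) (i : I) (j : J) :
    histogram (plantedDataset pos b) (some (i, j)) = histogram (b i) (some j) := by
  have : ({l | plantedDataset pos b l = some (i, j)} : Finset (Fin n)) =
      ({s | b i s = some j} : Finset S).map ((Function.Embedding.sectR i S).trans pos) := by
    ext l
    simp [plantedDataset_eq_some_iff, and_comm]
  rw [histogram, this, Finset.card_map, histogram]

theorem hammingDist_plantedDataset_update_le [DecidableEq I] [DecidableEq J] [Fintype S]
    (b : I → S → Option J) (i : I) (a a' : S → Option J) :
    hammingDist (plantedDataset pos (Function.update b i a))
      (plantedDataset pos (Function.update b i a')) ≤ hammingDist a a' := by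
  rw [hammingDist, hammingDist, ← Finset.card_map ((Function.Embedding.sectR i S).trans pos)]
  refine Finset.card_le_card fun l hl => ?_
  contrapose! hl
  simp only [Finset.mem_map, Finset.mem_filter, Finset.mem_univ, true_and, not_exists, not_and,
    not_imp_not, not_not, ne_eq] at hl ⊢
  refine Option.ext fun ⟨i', j⟩ => ?_
  simp only [plantedDataset_eq_some_iff]
  refine exists_congr fun s => and_congr_right fun hs => ?_
  obtain rfl | hi := eq_or_ne i' i
  · rw [Function.update_self, Function.update_self, hl s hs]
  · rw [Function.update_of_ne hi, Function.update_of_ne hi]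

theorem dist_sq_le_sum_sq_sub {J : Type*} [Fintype J] (z w : J → ℝ) :
    dist z w ^ 2 ≤ ∑ j, (z j - w j) ^ 2 := by
  rw [← Real.le_sqrt dist_nonneg (by positivity), dist_pi_le_iff (Real.sqrt_nonneg _)]
  exact fun j => Real.abs_le_sqrt
    (Finset.single_le_sum (f := fun j => (z j - w j) ^ 2) (fun _ _ => sq_nonneg _)
      (Finset.mem_univ j))

theorem sum_dist_sq_histogram_le [Fintype I] [DecidableEq I] [Fintype J] [DecidableEq J]
    [Fintype S] (b : I → S → Option J) (z : Option (I × J) → ℝ) :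
    ∑ i, dist (fun j => z (some (i, j))) (fun j => histogram (b i) (some j)) ^ 2 ≤
      ∑ u, (z u - histogram (plantedDataset pos b) u) ^ 2 := by
  calc _ ≤ ∑ i, ∑ j, (z (some (i, j)) - histogram (plantedDataset pos b) (some (i, j))) ^ 2 := by
        gcongr with i
        simpa only [histogram_plantedDataset] using dist_sq_le_sum_sq_sub _ _
    _ ≤ ∑ u, (z u - histogram (plantedDataset pos b) u) ^ 2 := by
        rw [Fintype.sum_option, Fintype.sum_prod_type]
        exact le_add_of_nonneg_left (sq_nonneg _)

end PlantedDataset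

section Packing

theorem EstimatesHistogram.planted_bound {I J S A : Type*} [Fintype I] [DecidableEq I]
    [Nonempty I] [Fintype J] [DecidableEq J] [Fintype S] [Fintype A] {n : ℕ}
    {law : (Fin n → Option (I × J)) → Measure (Option (I × J) → ℝ)}
    [∀ x, IsProbabilityMeasure (law x)] {p B ε δ ρ : ℝ} (hest : EstimatesHistogram law p B)
    (hlaw : IsDifferentiallyPrivate law ε δ) (hp : 0 ≤ p) (hε : 0 ≤ ε) (hδ : 0 ≤ δ)
    (pos : I × S ↪ Fin n) {g : A → S → Option J} (hρ : 0 < ρ)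
    (hg : Pairwise fun a a' =>
      2 * ρ ≤ dist (fun j => histogram (g a) (some j)) fun j => histogram (g a') (some j))
    (c : A) {d : A → ℕ} (hd : ∀ a, hammingDist (g a) (g c) ≤ d a) :
    p * (Fintype.card I - B / ρ ^ 2) * ∑ a, (Real.exp ε ^ d a)⁻¹ ≤
      Fintype.card I * (1 + ∑ a, (Real.exp ε ^ d a)⁻¹ *
        (δ * ∑ i ∈ Finset.range (d a), Real.exp ε ^ i)) := by
  have hdist : ∀ (b : I → A) i a, hammingDist (plantedDataset pos (g ∘ Function.update b i a))
      (plantedDataset pos (g ∘ Function.update b i c)) ≤ d a := fun b i a => by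
    simp only [Function.comp_update]
    exact (hammingDist_plantedDataset_update_le pos _ i _ _).trans (hd a)
  exact mul_card_sub_mul_sum_le_of_decoding (law := fun b => law (plantedDataset pos (g ∘ b)))
    (est := fun i z j => z (some (i, j))) (by fun_prop) hp hρ hg
    (fun b => (hest _).trans (measureReal_mono fun z hz =>
      (sum_dist_sq_histogram_le pos (g ∘ b) z).trans hz))
    c (fun a => pow_pos (Real.exp_pos ε) (d a))
    fun b i a S hS => hlaw.measureReal_le_of_hammingDist_le hε hδ hS (hdist b i a)

theorem EstimatesHistogram.packing_bound {U J S A : Type*} [Fintype U] [DecidableEq U]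
    [Fintype J] [DecidableEq J] [Fintype S] [Fintype A] {n : ℕ}
    {law : (Fin n → U) → Measure (U → ℝ)} [∀ x, IsProbabilityMeasure (law x)] {p B ε δ ρ : ℝ}
    (hest : EstimatesHistogram law p B) (hlaw : IsDifferentiallyPrivate law ε δ) (hp : 0 < p)
    (hε : 0 ≤ ε) (hδ : 0 ≤ δ) {r : ℕ} (hU : r * Fintype.card J < Fintype.card U)
    (hn : r * Fintype.card S ≤ n) {g : A → S → Option J} (hρ : 0 < ρ)
    (hg : Pairwise fun a a' =>
      2 * ρ ≤ dist (fun j => histogram (g a) (some j)) fun j => histogram (g a') (some j))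
    (c : A) {d : A → ℕ} (hd : ∀ a, hammingDist (g a) (g c) ≤ d a) :
    p * (r - B / ρ ^ 2) * ∑ a, (Real.exp ε ^ d a)⁻¹ ≤
      r * (1 + ∑ a, (Real.exp ε ^ d a)⁻¹ *
        (δ * ∑ i ∈ Finset.range (d a), Real.exp ε ^ i)) := by
  obtain ⟨e⟩ : Nonempty (Option (Fin r × J) ↪ U) :=
    Function.Embedding.nonempty_of_card_le (by simpa using hU)
  obtain ⟨pos⟩ : Nonempty (Fin r × S ↪ Fin n) :=
    Function.Embedding.nonempty_of_card_le (by simpa using hn)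
  obtain rfl | hr := Nat.eq_zero_or_pos r
  · have : Nonempty U := ⟨e none⟩
    have hB : 0 ≤ p * (B / ρ ^ 2) * ∑ a, (Real.exp ε ^ d a)⁻¹ := by
      have := hest.nonneg hp
      positivity
    simpa using hB
  · have : NeZero r := ⟨hr.ne'⟩
    have hcomp : Measurable fun z : U → ℝ => z ∘ e := by fun_prop
    have : ∀ x, IsProbabilityMeasure ((law (e ∘ x)).map (· ∘ e)) := fun x =>
      Measure.isProbabilityMeasure_map hcomp.aemeasurable
    simpa only [Fintype.card_fin] using (hest.comp_injective e.injective).planted_bound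
      ((hlaw.comp_injective e.injective).map hcomp) hp.le hε hδ pos hρ hg c hd

/-- The code of three blocks of size `2 * k`, with `0`, `k` and `2 * k` points `some ()`, planted
when `ε ≤ 1`. At distance `k` about `1 / ε`, privacy allows two words to be told apart with
probability `2 / 3`, but not three. -/
def unaryCode (k : ℕ) : Fin 3 → Fin k ⊕ Fin k → Option Unit :=
  ![fun _ => none, Sum.elim (fun _ => some ()) fun _ => none, fun _ => some ()]

theorem histogram_unaryCode (k : ℕ) (a : Fin 3) :
    histogram (unaryCode k a) (some ()) = (a : ℕ) * k := by
  simp only [histogram, Finset.card_filter, Fintype.sum_sum_type]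
  fin_cases a <;> simp [unaryCode, two_mul]

theorem hammingDist_unaryCode_one_le (k : ℕ) (a : Fin 3) :
    hammingDist (unaryCode k a) (unaryCode k 1) ≤ if a = 1 then 0 else k := by
  fin_cases a <;> simp [hammingDist, unaryCode, Finset.card_filter]

theorem le_dist_histogram_unaryCode (k : ℕ) {a a' : Fin 3} (h : a ≠ a') :
    k ≤ dist (fun j => histogram (unaryCode k a) (some j))
      fun j => histogram (unaryCode k a') (some j) := by
  have hsep : 1 ≤ |((a : ℕ) : ℝ) - (a' : ℕ)| := by
    have hz : ((a : ℕ) : ℤ) - (a' : ℕ) ≠ 0 := by omega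
    exact_mod_cast Int.one_le_abs hz
  calc (k : ℝ) ≤ |((a : ℕ) : ℝ) - (a' : ℕ)| * k := le_mul_of_one_le_left (Nat.cast_nonneg k) hsep
    _ = dist (histogram (unaryCode k a) (some ())) (histogram (unaryCode k a') (some ())) := by
        rw [histogram_unaryCode, histogram_unaryCode, Real.dist_eq, ← sub_mul, abs_mul,
          Nat.abs_cast]
    _ ≤ _ := dist_le_pi_dist (fun j => histogram (unaryCode k a) (some j))
        (fun j => histogram (unaryCode k a') (some j)) ()

theorem histogram_const_unit {U : Type*} [DecidableEq U] (a u : U) :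
    histogram (fun _ : Unit => a) u = if a = u then 1 else 0 := by
  simp only [histogram]
  split_ifs with h <;> simp [h]

theorem one_le_dist_histogram_const_unit {J : Type*} [Fintype J] [DecidableEq J] {a a' : Option J}
    (h : a ≠ a') :
    1 ≤ dist (fun j => histogram (fun _ : Unit => a) (some j))
      fun j => histogram (fun _ : Unit => a') (some j) := by
  wlog ha : ∃ j, a = some j generalizing a a'
  · rw [dist_comm]
    exact this h.symm (by cases a <;> cases a' <;> simp_all)
  obtain ⟨j, rfl⟩ := ha
  calc 1 = dist (histogram (fun _ : Unit => some j) (some j))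
        (histogram (fun _ : Unit => a') (some j)) := by
        simp [histogram_const_unit, h.symm]
    _ ≤ _ := dist_le_pi_dist (fun i => histogram (fun _ : Unit => some j) (some i))
        (fun i => histogram (fun _ : Unit => a') (some i)) j

section FloorInv

variable {ε : ℝ}

theorem floor_inv_mul_le_one (hε : 0 < ε) : ⌊1 / ε⌋₊ * ε ≤ 1 :=
  (le_div_iff₀ hε).1 (Nat.floor_le (by positivity))

theorem half_le_floor_inv_mul (hε : 0 < ε) (hε1 : ε ≤ 1) : 1 / 2 ≤ ⌊1 / ε⌋₊ * ε := by
  have hlt : 1 < (⌊1 / ε⌋₊ + 1) * ε := (div_lt_iff₀ hε).1 (Nat.lt_floor_add_one _)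
  have hone : (1 : ℝ) ≤ ⌊1 / ε⌋₊ :=
    Nat.one_le_cast.2 (Nat.floor_pos.2 (by rwa [one_le_div hε]))
  nlinarith

theorem exp_pow_floor_inv_le (hε : 0 < ε) : Real.exp ε ^ ⌊1 / ε⌋₊ ≤ 3 := by
  rw [← Real.exp_nat_mul]
  exact (Real.exp_le_exp.2 (floor_inv_mul_le_one hε)).trans Real.exp_one_lt_three.le

theorem sum_exp_pow_floor_inv_le (hε : 0 < ε) :
    ε * ∑ i ∈ Finset.range ⌊1 / ε⌋₊, Real.exp ε ^ i ≤ 3 := by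
  calc ε * ∑ i ∈ Finset.range ⌊1 / ε⌋₊, Real.exp ε ^ i
      ≤ ε * ∑ _i ∈ Finset.range ⌊1 / ε⌋₊, (3 : ℝ) := by
        gcongr with _ hi
        exact (pow_le_pow_right₀ (Real.one_le_exp hε.le) (Finset.mem_range.1 hi).le).trans
          (exp_pow_floor_inv_le hε)
    _ = ⌊1 / ε⌋₊ * ε * 3 := by
        rw [Finset.sum_const, Finset.card_range, nsmul_eq_mul]
        ring
    _ ≤ 1 * 3 := by
        gcongr
        exact floor_inv_mul_le_one hε
    _ = 3 := one_mul 3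

end FloorInv

theorem EstimatesHistogram.card_le_of_delta_le {U : Type*} [Fintype U] [DecidableEq U] {n : ℕ}
    {law : (Fin n → U) → Measure (U → ℝ)} [∀ x, IsProbabilityMeasure (law x)] {B ε δ : ℝ}
    (hest : EstimatesHistogram law (2 / 3) B) (hlaw : IsDifferentiallyPrivate law ε δ)
    (hε : 0 < ε) (hε1 : ε ≤ 1) (hδ : 0 ≤ δ) (hδε : δ ≤ 1 / 100 * ε) {r : ℕ}
    (hU : r < Fintype.card U) (hn : r * (2 * ⌊1 / ε⌋₊) ≤ n) : r ≤ 320 * ε ^ 2 * B := by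
  set k := ⌊1 / ε⌋₊
  have hk : (0 : ℝ) < k := Nat.cast_pos.2 (Nat.floor_pos.2 (by rwa [one_le_div hε]))
  have hsum : δ * ∑ i ∈ Finset.range k, Real.exp ε ^ i ≤ 3 / 100 := by
    calc δ * ∑ i ∈ Finset.range k, Real.exp ε ^ i
        ≤ 1 / 100 * ε * ∑ i ∈ Finset.range k, Real.exp ε ^ i := by gcongr
      _ ≤ 3 / 100 := by linarith [sum_exp_pow_floor_inv_le hε]
  have key := hest.packing_bound hlaw (by norm_num) hε.le hδ (r := r) (by simpa using hU)
    (by simpa [two_mul] using hn) (half_pos hk)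
    (fun a a' haa => (mul_div_cancel₀ (k : ℝ) two_ne_zero).trans_le
      (le_dist_histogram_unaryCode k haa)) 1 (hammingDist_unaryCode_one_le k)
  have hB : r / 20 ≤ B / (k / 2) ^ 2 := by
    have hw : 1 / 3 ≤ (Real.exp ε ^ k)⁻¹ := by
      rw [one_div]
      exact inv_anti₀ (by positivity) (exp_pow_floor_inv_le hε)
    simp only [Fin.sum_univ_three, zero_ne_one, Fin.reduceEq, ↓reduceIte, pow_zero, inv_one,
      Finset.range_zero, Finset.sum_empty, mul_zero, add_zero] at key
    set w := (Real.exp ε ^ k)⁻¹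
    set s := δ * ∑ i ∈ Finset.range k, Real.exp ε ^ i
    have hrw : r * (1 / 3) ≤ r * w := by gcongr
    have hrs : r * w * s ≤ r * w * (3 / 100) := by gcongr
    refine le_of_mul_le_mul_right (a := w + 1 + w) ?_ (by positivity)
    linarith
  rw [le_div_iff₀ (by positivity)] at hB
  calc (r : ℝ) = 4 * r * (1 / 2) ^ 2 := by ring
    _ ≤ 4 * r * (k * ε) ^ 2 := by
        gcongr
        exact half_le_floor_inv_mul hε hε1
    _ = 320 * ε ^ 2 * (r / 20 * (k / 2) ^ 2) := by ring
    _ ≤ 320 * ε ^ 2 * B := by gcongr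

theorem EstimatesHistogram.card_le_of_two_mul_exp_le {U : Type*} [Fintype U] [DecidableEq U]
    {n : ℕ} {law : (Fin n → U) → Measure (U → ℝ)} [∀ x, IsProbabilityMeasure (law x)] {p B ε δ : ℝ}
    (hest : EstimatesHistogram law p B) (hlaw : IsDifferentiallyPrivate law ε δ) (hp : 0 < p)
    (hε : 0 ≤ ε) (hδ : 0 ≤ δ) {r K : ℕ} (hK : 2 * Real.exp ε ≤ (p - δ) * K)
    (hU : r * K < Fintype.card U) (hn : r ≤ n) : (p - δ) * r ≤ 12 * B := by
  have : Nonempty U := Fintype.card_pos_iff.1 ((Nat.zero_le _).trans_lt hU)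
  have hp1 : p ≤ 1 := (hest fun _ => Classical.arbitrary U).trans measureReal_le_one
  have hB : 0 ≤ B := hest.nonneg hp
  have hE : 0 < Real.exp ε := Real.exp_pos ε
  have hK0 : (0 : ℝ) < K := by
    refine (Nat.cast_nonneg K).lt_of_ne fun h => ?_
    rw [← h] at hK
    linarith
  have hEK : Real.exp ε ≤ K / 2 := by nlinarith
  have hd : ∀ a : Option (Fin K), hammingDist (fun _ : Unit => a) (fun _ => none) ≤
      a.elim 0 fun _ => 1 := by
    rintro (_ | j) <;> simp [hammingDist]
  have key := hest.packing_bound hlaw hp hε hδ (r := r) (J := Fin K) (S := Unit) (by simpa using hU)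
    (by simpa using hn) one_half_pos (fun a a' haa => (mul_div_cancel₀ (1 : ℝ) two_ne_zero).trans_le
      (one_le_dist_histogram_const_unit haa)) none hd
  simp only [Fintype.sum_option, Option.elim, pow_zero, inv_one, Finset.range_zero,
    Finset.sum_empty, mul_zero, zero_add, Finset.sum_const, Finset.card_univ, nsmul_eq_mul,
    Fintype.card_fin, pow_one, Finset.range_one, Finset.sum_singleton, mul_one] at key
  have key' : p * (r - 4 * B) * (Real.exp ε + K) ≤ r * (Real.exp ε + K * δ) := by
    refine le_of_mul_le_mul_right (Eq.trans_le ?_ (key.trans_eq ?_)) (inv_pos.2 hE) <;>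
      field_simp
    ring
  refine le_of_mul_le_mul_right (a := (K : ℝ) / 2) ?_ (by positivity)
  calc (p - δ) * r * (K / 2) = r * ((p - δ) * K - (p - δ) * K / 2) := by ring
    _ ≤ r * ((p - δ) * K - (1 - p) * Real.exp ε) := by
        gcongr
        nlinarith
    _ ≤ p * (4 * B * (Real.exp ε + K)) := by linarith
    _ ≤ 1 * (4 * B * (K / 2 + K)) := by gcongr
    _ = 12 * B * (K / 2) := by ring

end Packing

section HistogramEstimate

open Matrix

variable {N m n : ℕ} {H : Matrix (Fin m) (Fin m) ℝ}

theorem queryAnswer_scaledRowQueries (hm : m ≤ N) (x : Fin n → Fin m) (t : Fin m) :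
    queryAnswer (scaledRowQueries N H (Fin.castLE hm t)) (Fin.castLE hm ∘ x) =
      √2 ^ (t : ℕ) * (H *ᵥ histogram x) t / n := by
  simp only [queryAnswer, Function.comp_apply, scaledRowQueries_castLE,
    sum_comp_eq_sum_mul_histogram fun u => √2 ^ (t : ℕ) * H t u, mulVec, dotProduct,
    Finset.mul_sum, mul_assoc]

/-- The histogram estimate obtained from answers `y` to the queries `scaledRowQueries N H` on a
dataset of size `n`, by undoing the scaling and inverting the Hadamard matrix `H`. -/
noncomputable def histogramEstimate (H : Matrix (Fin m) (Fin m) ℝ) (hm : m ≤ N) (n : ℕ)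
    (y : Fin N → ℝ) (u : Fin m) : ℝ :=
  (Hᵀ *ᵥ fun t => n * y (Fin.castLE hm t) / √2 ^ (t : ℕ)) u / m

theorem measurable_histogramEstimate (H : Matrix (Fin m) (Fin m) ℝ) (hm : m ≤ N) (n : ℕ) :
    Measurable (histogramEstimate H hm n) := by
  unfold histogramEstimate mulVec dotProduct
  fun_prop

theorem sq_mul_div_sqrt_two_pow_sub_le (hH : H.IsHadamard) (hm : m ≤ N) (hn : 0 < n) {ε C : ℝ}
    (hε : 0 < ε) (hC : 0 ≤ C) (x : Fin n → Fin m) (t : Fin m) {a : ℝ}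
    (ha : |queryAnswer (scaledRowQueries N H (Fin.castLE hm t)) (Fin.castLE hm ∘ x) - a| ≤
      C * gammaTwo (queryPrefix (scaledRowQueries N H) (Fin.castLE hm t)) / (ε * n)) :
    (n * a / √2 ^ (t : ℕ) - (H *ᵥ histogram x) t) ^ 2 ≤ 2 * C ^ 2 / ε ^ 2 := by
  have hn0 : (0 : ℝ) < n := Nat.cast_pos.2 hn
  have hγ := gammaTwo_queryPrefix_scaledRowQueries_le hH (Fin.castLE hm t)
  rw [queryAnswer_scaledRowQueries] at ha
  rw [Fin.val_castLE, pow_succ] at hγ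
  set r := √2 ^ (t : ℕ)
  have hr : 0 < r := by positivity
  set s := (H *ᵥ histogram x) t
  have habs : |n * a / r - s| ≤ C * √2 / ε := by
    calc |n * a / r - s| = n / r * |r * s / n - a| := by
          rw [← abs_of_pos (div_pos hn0 hr), ← abs_mul, abs_sub_comm]
          congr 1
          field_simp
      _ ≤ n / r * (C * (r * √2) / (ε * n)) := by
          gcongr
          exact ha.trans (by gcongr)
      _ = C * √2 / ε := by field_simp
  calc (n * a / r - s) ^ 2 ≤ (C * √2 / ε) ^ 2 :=
        sq_le_sq' (neg_le_of_abs_le habs) (le_of_abs_le habs)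
    _ = 2 * C ^ 2 / ε ^ 2 := by
        rw [div_pow, mul_pow, Real.sq_sqrt zero_le_two, mul_comm]

theorem sum_sq_histogramEstimate_sub_le (hH : H.IsHadamard) (hm : m ≤ N) (hm0 : 0 < m)
    (hn : 0 < n) {ε C : ℝ} (hε : 0 < ε) (hC : 0 ≤ C) (x : Fin n → Fin m) {y : Fin N → ℝ}
    (hy : ∀ t, |queryAnswer (scaledRowQueries N H t) (Fin.castLE hm ∘ x) - y t| ≤
      C * gammaTwo (queryPrefix (scaledRowQueries N H) t) / (ε * n)) :
    ∑ u, (histogramEstimate H hm n y u - histogram x u) ^ 2 ≤ 2 * C ^ 2 / ε ^ 2 := by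
  have : NeZero m := ⟨hm0.ne'⟩
  have hm' : (0 : ℝ) < m := Nat.cast_pos.2 hm0
  have hinv := sum_sq_transpose_mulVec_div_card_sub_of_isHadamard hH
    (fun t => n * y (Fin.castLE hm t) / √2 ^ (t : ℕ)) (histogram x)
  rw [Fintype.card_fin] at hinv
  simp only [histogramEstimate]
  rw [hinv, div_le_iff₀ hm']
  calc _ ≤ ∑ _t : Fin m, 2 * C ^ 2 / ε ^ 2 := Finset.sum_le_sum fun t _ =>
        sq_mul_div_sqrt_two_pow_sub_le hH hm hn hε hC x t (hy _)
    _ = 2 * C ^ 2 / ε ^ 2 * m := by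
        rw [Finset.sum_const, Finset.card_univ, Fintype.card_fin, nsmul_eq_mul, mul_comm]

theorem InteractiveAlgorithm.measurable_answers {U : Type v} (M : InteractiveAlgorithm.{u, v} U n)
    (x : Fin n → U) {k : ℕ} (q : Fin k → U → ℝ) : Measurable (M.answers x q) :=
  measurable_pi_lambda _ fun _ => M.measurable_answer _ _

theorem nonneg_of_isAccurate_scaledRowQueries (hH : H.IsHadamard) (hm : m ≤ N) (hm0 : 0 < m)
    (hn : 0 < n) {ε C : ℝ} (hε : 0 < ε) {M : InteractiveAlgorithm.{u, 0} (Fin N) n}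
    (hM : M.IsAccurate (scaledRowQueries N H) ε C) : 0 ≤ C := by
  let t : Fin m := ⟨0, hm0⟩
  have hpos := (show (0 : ℝ) < 2 / 3 by norm_num).trans_le (hM fun _ => Fin.castLE hm t)
  obtain ⟨ω, hω⟩ := nonempty_of_measureReal_ne_zero hpos.ne'
  have : (0 : ℝ) < n := Nat.cast_pos.2 hn
  have hbound := (abs_nonneg _).trans (hω (Fin.castLE hm t))
  rw [le_div_iff₀ (by positivity), zero_mul] at hbound
  exact nonneg_of_mul_nonneg_left hbound (gammaTwo_queryPrefix_scaledRowQueries_pos hH hm t)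

theorem estimatesHistogram_of_isAccurate (hH : H.IsHadamard) (hm : m ≤ N) (hm0 : 0 < m)
    (hn : 0 < n) {ε C : ℝ} (hε : 0 < ε) {M : InteractiveAlgorithm.{u, 0} (Fin N) n}
    (hM : M.IsAccurate (scaledRowQueries N H) ε C) :
    EstimatesHistogram (fun x : Fin n → Fin m =>
      (M.transcriptLaw (scaledRowQueries N H) (Fin.castLE hm ∘ x)).map (histogramEstimate H hm n))
      (2 / 3) (2 * C ^ 2 / ε ^ 2) := fun x => by
  have hest := measurable_histogramEstimate H hm n
  have hans := M.measurable_answers (Fin.castLE hm ∘ x) (scaledRowQueries N H)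
  simp only [InteractiveAlgorithm.transcriptLaw]
  rw [Measure.map_map hest hans,
    map_measureReal_apply (hest.comp hans) (measurableSet_le (by fun_prop) measurable_const)]
  exact (hM _).trans (measureReal_mono fun ω hω => sum_sq_histogramEstimate_sub_le hH hm hm0 hn hε
    (nonneg_of_isAccurate_scaledRowQueries hH hm hm0 hn hε hM) x hω)

end HistogramEstimate

section ErrorFactor

variable {N m : ℕ} {H : Matrix (Fin m) (Fin m) ℝ} {ε δ : ℝ}

theorem errorFactorAtLeast_of_estimatesHistogram (hH : H.IsHadamard) (hm : m ≤ N) (hm0 : 0 < m)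
    (hε : 0 < ε) {c : ℝ} (hc : 0 ≤ c) (n₀ : ℕ)
    (h : ∀ n ≥ n₀, ∀ law : (Fin n → Fin m) → Measure (Fin m → ℝ),
      (∀ x, IsProbabilityMeasure (law x)) → IsDifferentiallyPrivate law ε δ →
        ∀ B, EstimatesHistogram law (2 / 3) B → 2 * c ^ 2 * (m - 1 : ℕ) ≤ ε ^ 2 * B) :
    ErrorFactorAtLeast.{u} (scaledRowQueries N H) ε δ c := by
  refine ⟨n₀ + 1, fun n hn M hM C hacc => ?_⟩
  have hn0 : 0 < n := (Nat.succ_pos n₀).trans_le hn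
  have hC := nonneg_of_isAccurate_scaledRowQueries hH hm hm0 hn0 hε hacc
  have hans := M.measurable_answers (q := scaledRowQueries N H)
  have hest := measurable_histogramEstimate H hm n
  have hprob : ∀ x, IsProbabilityMeasure (M.transcriptLaw (scaledRowQueries N H) x) := fun x =>
    Measure.isProbabilityMeasure_map (hans x).aemeasurable
  have hB := h n ((Nat.le_succ n₀).trans hn) _
    (fun _ => Measure.isProbabilityMeasure_map hest.aemeasurable)
    (((hM N (scaledRowQueries N H)).comp_injective (Fin.castLE_injective hm)).map hest) _
    (estimatesHistogram_of_isAccurate hH hm hm0 hn0 hε hacc)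
  rw [mul_div_cancel₀ _ (by positivity)] at hB
  calc c * √(Real.logb 2 (gammaTwo (queryMatrix (scaledRowQueries N H))))
      ≤ c * √(m - 1 : ℕ) := by
        gcongr
        exact logb_gammaTwo_scaledRowQueries_le hH hm hm0
    _ = √(c ^ 2 * (m - 1 : ℕ)) := by rw [Real.sqrt_mul (sq_nonneg c), Real.sqrt_sq hc]
    _ ≤ C := (Real.sqrt_le_left hC).2 (by linarith)

theorem errorFactorAtLeast_of_delta_le (hH : H.IsHadamard) (hm : m ≤ N) (hm0 : 0 < m)
    (hε : 0 < ε) (hε1 : ε ≤ 1) (hδ : 0 ≤ δ) (hδε : δ ≤ 1 / 100 * ε) :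
    ErrorFactorAtLeast.{u} (scaledRowQueries N H) ε δ (1 / 26) := by
  refine errorFactorAtLeast_of_estimatesHistogram hH hm hm0 hε (by norm_num)
    ((m - 1) * (2 * ⌊1 / ε⌋₊)) fun n hn law _ hlaw B hest => ?_
  have hcard := hest.card_le_of_delta_le hlaw hε hε1 hδ hδε
    (by simpa using Nat.sub_lt hm0 one_pos) hn
  have : (0 : ℝ) ≤ (m - 1 : ℕ) := Nat.cast_nonneg _
  linarith

theorem errorFactorAtLeast_of_two_mul_exp_le (hH : H.IsHadamard) (hm : m ≤ N) (hε : 0 < ε)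
    (hδ : 0 ≤ δ) {K : ℕ} (hK : 2 * Real.exp ε ≤ (2 / 3 - δ) * K) (hKm : K < m) :
    ErrorFactorAtLeast.{u} (scaledRowQueries N H) ε δ (ε * √((2 / 3 - δ) / (48 * K))) := by
  have hm0 : 0 < m := (Nat.zero_le K).trans_lt hKm
  have hτK : 0 < (2 / 3 - δ) * K := lt_of_lt_of_le (by positivity) hK
  have hK0 : (0 : ℝ) < K := (Nat.cast_nonneg K).lt_of_ne (right_ne_zero_of_mul hτK.ne').symm
  have hτ : 0 < 2 / 3 - δ := pos_of_mul_pos_left hτK hK0.le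
  set r := (m - 1) / K
  have hmr : m - 1 ≤ 2 * (r * K) := by
    have hlt : m - 1 < r * K + K := Nat.lt_div_mul_add (Nat.cast_pos.1 hK0)
    have hle : K ≤ r * K := Nat.le_mul_of_pos_left K
      (Nat.div_pos (Nat.le_sub_one_of_lt hKm) (Nat.cast_pos.1 hK0))
    omega
  refine errorFactorAtLeast_of_estimatesHistogram hH hm hm0 hε (by positivity) r
    fun n hn law _ hlaw B hest => ?_
  have hrK : r * K < Fintype.card (Fin m) := by
    rw [Fintype.card_fin]
    exact (Nat.div_mul_le_self _ _).trans_lt (Nat.sub_lt hm0 one_pos)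
  have hB := hest.card_le_of_two_mul_exp_le hlaw (by norm_num) hε.le hδ hK hrK hn
  calc 2 * (ε * √((2 / 3 - δ) / (48 * K))) ^ 2 * (m - 1 : ℕ)
      = ε ^ 2 * ((2 / 3 - δ) / (24 * K) * (m - 1 : ℕ)) := by
        rw [mul_pow, Real.sq_sqrt (by positivity)]
        field_simp
        ring
    _ ≤ ε ^ 2 * ((2 / 3 - δ) / (24 * K) * (2 * (r * K))) := by
        gcongr
        exact_mod_cast hmr
    _ = ε ^ 2 * ((2 / 3 - δ) * r / 12) := by
        field_simp
        ring
    _ ≤ ε ^ 2 * B := by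
        gcongr
        linarith

end ErrorFactor

section HardQueries

/-- The queries of the theorem: the geometrically scaled rows of Sylvester's Hadamard matrix of
order the largest power of two which is at most `N`. -/
noncomputable def hardQueries (N : ℕ) : Fin N → Fin N → ℝ :=
  scaledRowQueries N (sylvesterMatrix (Nat.log 2 N))

theorem hardQueries_two_pow (k : ℕ) (t u : Fin (2 ^ k)) :
    hardQueries (2 ^ k) t u = √2 ^ (t : ℕ) * sylvesterMatrix k t u := by
  rw [hardQueries, Nat.log_pow one_lt_two]
  exact scaledRowQueries_castLE le_rfl t u

theorem le_two_mul_two_pow_log_sub_one (N : ℕ) : N ≤ 2 * (2 ^ Nat.log 2 N - 1) + 1 := by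
  have := Nat.lt_pow_succ_log_self one_lt_two N
  omega

variable {N : ℕ}

theorem norm_hardQueries_zero (hN : 0 < N) : ‖hardQueries N ⟨0, hN⟩‖ = 1 :=
  norm_scaledRowQueries_zero (isHadamard_sylvesterMatrix _) (Nat.pow_log_le_self 2 hN.ne')
    (by positivity)

theorem le_logb_gammaTwo_hardQueries (hN : 2 ≤ N) :
    1 / 8 * N ≤ Real.logb 2 (gammaTwo (queryMatrix (hardQueries N))) := by
  have hle : (N : ℝ) ≤ 2 * (2 ^ Nat.log 2 N - 1 : ℕ) + 1 := by
    exact_mod_cast le_two_mul_two_pow_log_sub_one N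
  have h2N : (2 : ℝ) ≤ N := by exact_mod_cast hN
  calc 1 / 8 * (N : ℝ) ≤ (2 ^ Nat.log 2 N - 1 : ℕ) / 2 := by linarith
    _ ≤ _ := half_le_logb_gammaTwo_scaledRowQueries (isHadamard_sylvesterMatrix _)
        (Nat.pow_log_le_self 2 (by omega)) (by positivity)

theorem logb_gammaTwo_hardQueries_le (hN : 0 < N) :
    Real.logb 2 (gammaTwo (queryMatrix (hardQueries N))) ≤ N := by
  have hm := Nat.pow_log_le_self 2 hN.ne'
  calc _ ≤ ((2 ^ Nat.log 2 N - 1 : ℕ) : ℝ) :=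
        logb_gammaTwo_scaledRowQueries_le (isHadamard_sylvesterMatrix _) hm (by positivity)
    _ ≤ N := by exact_mod_cast (Nat.sub_le _ 1).trans hm

theorem errorFactorAtLeast_hardQueries (hN : 0 < N) {ε δ : ℝ} (hε : 0 < ε) (hε1 : ε ≤ 1)
    (hδ : 0 ≤ δ) (hδε : δ ≤ 1 / 100 * ε) : ErrorFactorAtLeast.{u} (hardQueries N) ε δ (1 / 26) :=
  errorFactorAtLeast_of_delta_le (isHadamard_sylvesterMatrix _) (Nat.pow_log_le_self 2 hN.ne')
    (by positivity) hε hε1 hδ hδε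

theorem exists_errorFactorAtLeast_hardQueries {ε δ : ℝ} (hε : 0 < ε) (hδ : 0 ≤ δ)
    (hδ' : δ < 2 / 3) :
    ∃ c : ℝ, 0 < c ∧ ∃ N₀ : ℕ, ∀ N ≥ N₀, ErrorFactorAtLeast.{u} (hardQueries N) ε δ c := by
  have hτ : 0 < 2 / 3 - δ := sub_pos.2 hδ'
  obtain ⟨K, hK⟩ := exists_nat_gt (2 * Real.exp ε / (2 / 3 - δ))
  have hK0 : (0 : ℝ) < K := lt_trans (by positivity) hK
  refine ⟨ε * √((2 / 3 - δ) / (48 * K)), by positivity, 2 * K + 2, fun N hN => ?_⟩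
  have hKm : K < 2 ^ Nat.log 2 N := by
    have := le_two_mul_two_pow_log_sub_one N
    omega
  exact errorFactorAtLeast_of_two_mul_exp_le (isHadamard_sylvesterMatrix _)
    (Nat.pow_log_le_self 2 (by omega)) hε hδ ((div_lt_iff₀' hτ).1 hK).le hKm

end HardQueries

theorem theorem5 :
    ∃ q : (N : ℕ) → Fin N → Fin N → ℝ,
      -- for `N` a power of two, `q N` are the scaled rows of a Hadamard matrix
      (∀ k : ℕ, ∃ H : Matrix (Fin (2 ^ k)) (Fin (2 ^ k)) ℝ,
        H.IsHadamard ∧ ∀ t u, q (2 ^ k) t u = Real.sqrt 2 ^ (t : ℕ) * H t u) ∧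
      -- `‖q_1‖_∞ = 1` (the norm of `Fin N → ℝ` is the sup norm)
      (∀ (N : ℕ) (hN : 0 < N), ‖q N ⟨0, hN⟩‖ = 1) ∧
      -- `log₂ γ₂(Q) = Θ(N)`
      (∃ a b : ℝ, 0 < a ∧ 0 < b ∧ ∀ N : ℕ, 2 ≤ N →
        a * N ≤ Real.logb 2 (gammaTwo (queryMatrix (q N))) ∧
        Real.logb 2 (gammaTwo (queryMatrix (q N))) ≤ b * N) ∧
      -- `C = Ω(√(log₂ γ₂(Q)))` with absolute constants, for every `N`
      (∃ c η : ℝ, 0 < c ∧ 0 < η ∧ ∀ N : ℕ, 0 < N →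
        ∀ ε δ : ℝ, 0 < ε → ε ≤ 1 → 0 ≤ δ → δ ≤ η * ε →
          ErrorFactorAtLeast.{u} (q N) ε δ c) ∧
      -- `C = Ω(√(log₂ γ₂(Q)))` as `N → ∞`, for arbitrary fixed privacy parameters
      (∀ ε δ : ℝ, 0 < ε → 0 ≤ δ → δ < 2 / 3 →
        ∃ c : ℝ, 0 < c ∧ ∃ N₀ : ℕ, ∀ N ≥ N₀, ErrorFactorAtLeast.{u} (q N) ε δ c) :=
  ⟨hardQueries,
    fun k => ⟨sylvesterMatrix k, isHadamard_sylvesterMatrix k, hardQueries_two_pow k⟩,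
    fun _ hN => norm_hardQueries_zero hN,
    ⟨1 / 8, 1, by norm_num, one_pos, fun N hN => ⟨le_logb_gammaTwo_hardQueries hN,
      (logb_gammaTwo_hardQueries_le (two_pos.trans_le hN)).trans_eq (one_mul _).symm⟩⟩,
    ⟨1 / 26, 1 / 100, by norm_num, by norm_num, fun _ hN _ _ hε hε1 hδ hδε =>
      errorFactorAtLeast_hardQueries hN hε hε1 hδ hδε⟩,
    fun _ _ hε hδ hδ' => exists_errorFactorAtLeast_hardQueries hε hδ hδ'⟩
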